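/- Let $d\ge 2$ and $A\in(0,1)$. For $N\in\mathbb N$, $N\ge 1$, let $\Omega_N=\{x=(x_1,\tilde x)\in\mathbb R\times\mathbb R^{d-1}: -N<x_1<N\}$, and let $H^1_0(\Omega_N)$ be the closure of $C_c^\infty(\Omega_N;\mathbb C)$ in the $H^1$ norm; its elements are extended by zero to $\mathbb R^d$, so that $H^1_0(\Omega_{N})\subset H^1_0(\Omega_{N'})$ for $N\le N'$. For $c\in\mathbb R$ and $\psi\in 1+H^1_0(\Omega_N)$ put $$I^c_N(\psi)=\frac12\int_{\Omega_N}|\nabla\psi|^2\,dx+\frac12\int_{\Omega_N}(|\psi|^2-1)^2(|\psi|^2-A)\,dx+c\int_{\Omega_N}\partial_{x_1}(\mathrm{Im}\,\psi)\,(\mathrm{Re}\,\psi-1)\,dx .$$ (The negative part of the second integrand is always integrable; if the integrand is not integrable, which can happen only for $d\ge4$, then $I^c_N(\psi)=+\infty$.) Given $\psi_0\in 1+H^1_0(\Omega_N)$, let $$\Gamma(N)=\{g\in C([0,1],\,1+H^1_0(\Omega_N)) : g(0)=1,\ g(1)=\psi_0\},\qquad \gamma_N(c)=\inf_{g\in\Gamma(N)}\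 \sup_{t\in[0,1]} I^c_N(g(t)).$$ (For $d\le 3$ the supremum is a maximum.) Then for every $c_0\in(0,2\sqrt{1-A})$ there exist an integer $N_0>0$, a function $\psi_0\in 1+H^1_0(\Omega_{N_0})$ and a constant $\chi(c_0)>0$ such that for all integers $N\ge N_0$ and all $c\in[c_0,2\sqrt{1-A})$: a) $I^c_N(\psi_0)<0$; b) $0<\gamma_N(c)\le\chi(c_0)$. -/

import Mathlib

open MeasureTheory
open scoped ContDiff ENNReal

noncomputable section

namespace CubicQuintic

/-- The space `L²(ℝ^d; ℂ)` for Lebesgue measure. -/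
abbrev L2 (d : ℕ) : Type :=
  Lp ℂ 2 (volume : Measure (EuclideanSpace ℝ (Fin d)))

/-- The classical partial derivative `∂_j η`. -/
def partialDeriv {d : ℕ} {F : Type*} [NormedAddCommGroup F] [NormedSpace ℝ F] (j : Fin d)
    (η : EuclideanSpace ℝ (Fin d) → F) (x : EuclideanSpace ℝ (Fin d)) : F :=
  fderiv ℝ η x (EuclideanSpace.single j 1)

/-- `g ∈ L²` is the weak partial derivative `∂_j f` of `f ∈ L²` on `ℝ^d`:
`∫ (∂_j η) f = - ∫ η g` for every test function `η ∈ C_c^∞(ℝ^d; ℝ)`. -/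
def IsWeakPartial {d : ℕ} (j : Fin d) (f g : L2 d) : Prop :=
  ∀ η : EuclideanSpace ℝ (Fin d) → ℝ, ContDiff ℝ ∞ η → HasCompactSupport η →
    ∫ x, partialDeriv j η x • f x = - ∫ x, η x • g x

theorem memLp_test {d : ℕ} {η : EuclideanSpace ℝ (Fin d) → ℝ} (h : Continuous η)
    (hc : HasCompactSupport η) : MemLp η 2 volume :=
  h.memLp_of_hasCompactSupport hc

theorem integrable_test_smul {d : ℕ} {η : EuclideanSpace ℝ (Fin d) → ℝ} (h : Continuous η)
    (hc : HasCompactSupport η) (f : L2 d) : Integrable (fun x => η x • f x) :=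
  memLp_one_iff_integrable.mp ((Lp.memLp f).smul (r := 1) (memLp_test h hc))

theorem continuous_partialDeriv {d : ℕ} (j : Fin d) {η : EuclideanSpace ℝ (Fin d) → ℝ}
    (h : ContDiff ℝ ∞ η) : Continuous (partialDeriv j η) :=
  (h.continuous_fderiv (by simp)).clm_apply continuous_const

theorem hasCompactSupport_partialDeriv {d : ℕ} (j : Fin d) {η : EuclideanSpace ℝ (Fin d) → ℝ}
    (hc : HasCompactSupport η) : HasCompactSupport (partialDeriv j η) :=
  hc.fderiv_apply ℝ _

theorem IsWeakPartial.zero {d : ℕ} (j : Fin d) : IsWeakPartial j (0 : L2 d) 0 := by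
  intro η _ _
  have h0 : ((0 : L2 d) : EuclideanSpace ℝ (Fin d) → ℂ) =ᵐ[volume] 0 := Lp.coeFn_zero ..
  rw [integral_eq_zero_of_ae (f := fun x => partialDeriv j η x • (0 : L2 d) x),
    integral_eq_zero_of_ae (f := fun x => η x • (0 : L2 d) x), neg_zero]
  · filter_upwards [h0] with x hx
    simp
  · filter_upwards [h0] with x hx
    simp

theorem integral_test_add {d : ℕ} {η : EuclideanSpace ℝ (Fin d) → ℝ} (h : Continuous η)
    (hc : HasCompactSupport η) (f g : L2 d) :
    ∫ x, η x • (f + g) x = (∫ x, η x • f x) + ∫ x, η x • g x := by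
  rw [← integral_add (integrable_test_smul h hc f) (integrable_test_smul h hc g)]
  refine integral_congr_ae ?_
  filter_upwards [Lp.coeFn_add f g] with x hx
  simp only [hx, Pi.add_apply, smul_add]

theorem integral_test_smul {d : ℕ} (η : EuclideanSpace ℝ (Fin d) → ℝ) (a : ℂ) (f : L2 d) :
    ∫ x, η x • (a • f) x = a * ∫ x, η x • f x := by
  rw [← integral_const_mul]
  refine integral_congr_ae ?_
  filter_upwards [Lp.coeFn_smul a f] with x hx
  simp only [hx, Pi.smul_apply, smul_eq_mul, Complex.real_smul]
  ring

/-- The Sobolev space `H¹(ℝ^d; ℂ)`, as the space of pairs `(φ, (∂_1 φ, …, ∂_d φ))` of a function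
`φ ∈ L²` and its weak partial derivatives, all in `L²`. It carries the norm
`‖φ‖²_{H¹} = ‖φ‖²_{L²} + ∑ j, ‖∂_j φ‖²_{L²}`. -/
def H1 (d : ℕ) : Submodule ℂ (WithLp 2 (L2 d × PiLp 2 (fun _ : Fin d => L2 d))) where
  carrier := {w | ∀ j, IsWeakPartial j w.fst (w.snd j)}
  zero_mem' := fun j => IsWeakPartial.zero j
  add_mem' := by
    intro a b ha hb j η hη hc
    have h1 := integral_test_add (continuous_partialDeriv j hη)
      (hasCompactSupport_partialDeriv j hc) a.fst b.fst
    have h2 := integral_test_add hη.continuous hc (a.snd j) (b.snd j)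
    change ∫ x, partialDeriv j η x • (a.fst + b.fst) x = - ∫ x, η x • (a.snd j + b.snd j) x
    rw [h1, h2, ha j η hη hc, hb j η hη hc, neg_add]
  smul_mem' := by
    intro a w hw j η hη hc
    change ∫ x, partialDeriv j η x • (a • w.fst) x = - ∫ x, η x • (a • w.snd j) x
    rw [integral_test_smul, integral_test_smul, hw j η hη hc, mul_neg]

/-- The underlying function of `φ ∈ H¹(ℝ^d)`. -/
def toFun {d : ℕ} (φ : H1 d) : EuclideanSpace ℝ (Fin d) → ℂ :=
  φ.1.fst

/-- The weak partial derivative `∂_j φ` of `φ ∈ H¹(ℝ^d)`. -/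
def weakPartial {d : ℕ} (φ : H1 d) (j : Fin d) : EuclideanSpace ℝ (Fin d) → ℂ :=
  φ.1.snd j

/-- The image of `C_c^∞(Ω; ℂ)` in `H¹(ℝ^d)`. -/
def testFunctions {d : ℕ} (Ω : Set (EuclideanSpace ℝ (Fin d))) : Submodule ℂ (H1 d) where
  carrier := {φ | ∃ η : EuclideanSpace ℝ (Fin d) → ℂ, ContDiff ℝ ∞ η ∧ HasCompactSupport η ∧
    tsupport η ⊆ Ω ∧ toFun φ =ᵐ[volume] η}
  zero_mem' := ⟨0, contDiff_const, HasCompactSupport.zero, by simp [tsupport],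
    Lp.coeFn_zero ..⟩
  add_mem' := by
    rintro a b ⟨η, h1, h2, h3, h4⟩ ⟨ζ, k1, k2, k3, k4⟩
    refine ⟨η + ζ, h1.add k1, h2.add k2, (tsupport_add η ζ).trans (Set.union_subset h3 k3), ?_⟩
    exact (Lp.coeFn_add a.1.fst b.1.fst).trans (h4.add k4)
  smul_mem' := by
    rintro a b ⟨η, h1, h2, h3, h4⟩
    refine ⟨fun x => a • η x, h1.const_smul a, h2.smul_left (f := fun _ => a),
      (tsupport_smul_subset_right (fun _ => a) η).trans h3, ?_⟩
    exact (Lp.coeFn_smul a b.1.fst).trans (h4.const_smul a)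

/-- The Sobolev space `H¹₀(Ω)`: the closure of `C_c^∞(Ω)` in the `H¹` norm. Its elements are
regarded as functions on `ℝ^d`, extended by zero outside `Ω`, so that `H¹₀(Ω) ⊆ H¹₀(Ω')` for
`Ω ⊆ Ω'`. -/
def H10 {d : ℕ} (Ω : Set (EuclideanSpace ℝ (Fin d))) : Submodule ℂ (H1 d) :=
  (testFunctions Ω).topologicalClosure

/-- The slab `Ω_N = {x ∈ ℝ^d : -N < x_1 < N}`; the first coordinate has index `0`. -/
def slab (d : ℕ) [NeZero d] (N : ℕ) : Set (EuclideanSpace ℝ (Fin d)) :=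
  {x | -(N : ℝ) < x 0 ∧ x 0 < (N : ℝ)}

/-- The point `ψ = 1 + φ` of the affine space `1 + H¹(ℝ^d)`. Elements of `1 + H¹₀(Ω)` are
represented by `φ = ψ - 1 ∈ H¹₀(Ω)`; note `∂_j ψ = ∂_j φ`. -/
def onePlus {d : ℕ} (φ : H1 d) : EuclideanSpace ℝ (Fin d) → ℂ :=
  fun x => 1 + toFun φ x

/-- The potential `(|ψ|² - 1)² (|ψ|² - A)` for `ψ = 1 + φ`. -/
def potential {d : ℕ} (A : ℝ) (φ : H1 d) (x : EuclideanSpace ℝ (Fin d)) : ℝ :=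
  (‖onePlus φ x‖ ^ 2 - 1) ^ 2 * (‖onePlus φ x‖ ^ 2 - A)

open Classical in
/-- The energy on the slab, for `ψ = 1 + φ`:
`E_N(ψ) = ½ ∫_{Ω_N} |∇ψ|² + ½ ∫_{Ω_N} (|ψ|² - 1)² (|ψ|² - A)`.

The first integral is always finite. The negative part of the potential is bounded and lives on
`{|ψ|² < A}`, which has finite measure when `A < 1`, so the potential integral is well defined in
`(-∞, +∞]` and equals `+∞` exactly when the potential is not integrable. -/
def energy {d : ℕ} [NeZero d] (A : ℝ) (N : ℕ) (φ : H1 d) : EReal :=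
  if IntegrableOn (potential A φ) (slab d N) then
    (((1 / 2) * (∫ x in slab d N, ∑ j, ‖weakPartial φ j x‖ ^ 2)
      + (1 / 2) * ∫ x in slab d N, potential A φ x : ℝ) : EReal)
  else ⊤

/-- The momentum on the slab, for `ψ = 1 + φ`:
`P_N(ψ) = - ∫_{Ω_N} ∂_{x_1}(Im ψ) (Re ψ - 1)`. The integrand is a product of two `L²` functions. -/
def momentum {d : ℕ} [NeZero d] (N : ℕ) (φ : H1 d) : ℝ :=
  - ∫ x in slab d N, (weakPartial φ 0 x).im * ((onePlus φ x).re - 1)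

/-- The action `I^c_N(ψ) = E_N(ψ) - c P_N(ψ)` for `ψ = 1 + φ`. -/
def action {d : ℕ} [NeZero d] (A c : ℝ) (N : ℕ) (φ : H1 d) : EReal :=
  energy A N φ - ((c * momentum N φ : ℝ) : EReal)

/-- The paths `Γ(N) = {g ∈ C([0,1], 1 + H¹₀(Ω_N)) : g(0) = 1, g(1) = ψ₀}`, with `g(t)` and
`ψ₀ = 1 + φ₀` represented by `g(t) - 1` and `φ₀`. -/
def paths {d : ℕ} [NeZero d] (N : ℕ) (φ₀ : H1 d) : Set C(unitInterval, H1 d) :=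
  {g | (∀ t, g t ∈ H10 (slab d N)) ∧ g 0 = 0 ∧ g 1 = φ₀}

/-- The mountain-pass level `γ_N(c) = inf_{g ∈ Γ(N)} max_{t ∈ [0,1]} I^c_N(g(t))`, where the
maximum along a path is read as a supremum in `(-∞, +∞]` (for `d ≤ 3` the action is finite and
continuous on `1 + H¹₀(Ω_N)`, so that the supremum is a maximum). -/
def mountainPassLevel {d : ℕ} [NeZero d] (A c : ℝ) (N : ℕ) (φ₀ : H1 d) : EReal :=
  ⨅ g ∈ paths N φ₀, ⨆ t : unitInterval, action A c N (g t)

end CubicQuintic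

end

open Filter Topology

noncomputable section

namespace CubicQuintic

variable {d : ℕ}

/-! Lower bound. Write `ψ = 1 + φ`. Near `1` the potential is `4(1 - A)(Re φ)²` up to superquadratic
terms, and the momentum term is the product `c ∂₁(Im φ) Re φ`. For `c² < 4(1 - A)`, completing the
square absorbs that product and leaves a positive multiple of `∫|∇φ|²`, which Poincaré's inequality
in the slab turns into a multiple of `‖φ‖²`. The remainder is at most a constant times `∫ |φ|^(2q)`
with `q = d/(d-1) > 1`; the Gagliardo–Nirenberg inequality for `|φ|²` bounds it by a constant times
`‖φ‖^(2q)`. Small spheres around `1` are thus barriers, which every path to a state of negative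
action must cross (`exists_action_lower_bound`, `mountainPassLevel_pos`).

Upper bound. Real profiles `1 - f` have no momentum, so their action does not depend on `c`, nor on
`N` once the slab contains the support. A widely dilated bump has negative energy, because the
potential scales like `R^d` and the gradient term like `R^(d-2)`. The segment from `1` to this
profile bounds the level uniformly (`exists_profile_energy_neg`, `mountainPassLevel_le_of_real`). -/

/-! ### Norms, test functions and weak derivatives -/

theorem H1.norm_sq_eq (φ : H1 d) : ‖φ‖ ^ 2 = ‖φ.1.fst‖ ^ 2 + ∑ j, ‖φ.1.snd j‖ ^ 2 := by
  rw [← PiLp.norm_sq_eq_of_L2, ← WithLp.prod_norm_sq_eq_of_L2]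
  rfl

theorem L2.norm_sq_eq (f : L2 d) : ‖f‖ ^ 2 = ∫ x, ‖f x‖ ^ 2 := by
  have h2 : inner ℂ f f = ∫ x, inner ℂ (f x) (f x) := L2.inner_def f f
  have h3 : ((‖f‖ ^ 2 : ℝ) : ℂ) = ((∫ x, ‖f x‖ ^ 2 : ℝ) : ℂ) := by
    have := inner_self_eq_norm_sq_to_K (𝕜 := ℂ) f
    rw [h2] at this
    push_cast
    rw [← integral_complex_ofReal]
    refine this.symm.trans (integral_congr_ae (.of_forall fun x => ?_))
    simp [inner_self_eq_norm_sq_to_K]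
  exact_mod_cast h3

theorem L2.integrable_norm_sq (f : L2 d) : Integrable (fun x => ‖f x‖ ^ 2) :=
  (Lp.memLp f).integrable_norm_pow (by norm_num)

theorem continuous_partialDeriv' {F : Type*} [NormedAddCommGroup F] [NormedSpace ℝ F] (j : Fin d)
    {u : EuclideanSpace ℝ (Fin d) → F} (h : ContDiff ℝ ∞ u) : Continuous (partialDeriv j u) :=
  (h.continuous_fderiv (by simp)).clm_apply continuous_const

theorem hasCompactSupport_partialDeriv' {F : Type*} [NormedAddCommGroup F] [NormedSpace ℝ F]
    (j : Fin d) {u : EuclideanSpace ℝ (Fin d) → F} (hc : HasCompactSupport u) :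
    HasCompactSupport (partialDeriv j u) :=
  hc.fderiv_apply ℝ _

theorem integral_partialDeriv_smul (j : Fin d) {η : EuclideanSpace ℝ (Fin d) → ℝ}
    {u : EuclideanSpace ℝ (Fin d) → ℂ} (hη : ContDiff ℝ ∞ η) (hc : HasCompactSupport η)
    (hu : ContDiff ℝ ∞ u) :
    ∫ x, partialDeriv j η x • u x = - ∫ x, η x • partialDeriv j u x := by
  have h := integral_smul_fderiv_eq_neg_fderiv_smul_of_integrable
    (μ := (volume : Measure (EuclideanSpace ℝ (Fin d)))) (𝕜 := ℝ) (f := η) (g := u)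
    (v := EuclideanSpace.single j 1)
    (((continuous_partialDeriv j hη).smul hu.continuous).integrable_of_hasCompactSupport
      (hasCompactSupport_partialDeriv j hc).smul_right)
    ((hη.continuous.smul (continuous_partialDeriv' j hu)).integrable_of_hasCompactSupport
      hc.smul_right)
    ((hη.continuous.smul hu.continuous).integrable_of_hasCompactSupport hc.smul_right)
    (fun x _ => (hη.differentiable (by simp)).differentiableAt)
    (fun x _ => (hu.differentiable (by simp)).differentiableAt)
  simp only [partialDeriv]
  rw [h, neg_neg]

/-- The element of `H¹(ℝ^d)` given by a smooth compactly supported function. -/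
def ofTest (u : EuclideanSpace ℝ (Fin d) → ℂ) (hu : ContDiff ℝ ∞ u) (hc : HasCompactSupport u) :
    H1 d :=
  ⟨WithLp.toLp 2 ((hu.continuous.memLp_of_hasCompactSupport hc).toLp u, WithLp.toLp 2 fun j =>
    ((continuous_partialDeriv' j hu).memLp_of_hasCompactSupport
      (hasCompactSupport_partialDeriv' j hc)).toLp (partialDeriv j u)), by
    intro j η hη hηc
    have h1 := (hu.continuous.memLp_of_hasCompactSupport (μ := volume) (p := 2) hc).coeFn_toLp
    have h2 := ((continuous_partialDeriv' j hu).memLp_of_hasCompactSupport (μ := volume) (p := 2)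
      (hasCompactSupport_partialDeriv' j hc)).coeFn_toLp
    refine Eq.trans (integral_congr_ae ?_) ((integral_partialDeriv_smul j hη hηc hu).trans
      (congrArg Neg.neg (integral_congr_ae ?_)))
    · filter_upwards [h1] with x hx
      exact congrArg (partialDeriv j η x • ·) hx
    · filter_upwards [h2] with x hx
      exact congrArg (η x • ·) hx.symm⟩

theorem toFun_ofTest {u : EuclideanSpace ℝ (Fin d) → ℂ} (hu : ContDiff ℝ ∞ u)
    (hc : HasCompactSupport u) : toFun (ofTest u hu hc) =ᵐ[volume] u :=
  (hu.continuous.memLp_of_hasCompactSupport hc).coeFn_toLp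

/-- Both sides have the same integral against every test function, so the fundamental lemma of the
calculus of variations applies. -/
theorem weakPartial_ae_eq {φ : H1 d} {u : EuclideanSpace ℝ (Fin d) → ℂ} (hu : ContDiff ℝ ∞ u)
    (h : toFun φ =ᵐ[volume] u) (j : Fin d) : weakPartial φ j =ᵐ[volume] partialDeriv j u := by
  refine ae_eq_of_integral_contDiff_smul_eq
    ((Lp.memLp (φ.1.snd j)).locallyIntegrable (by norm_num))
    (continuous_partialDeriv' j hu).locallyIntegrable fun g hg hgc => ?_
  have h1 := φ.2 j g hg hgc
  have h2 := integral_partialDeriv_smul j hg hgc hu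
  have h3 : ∫ x, partialDeriv j g x • φ.1.fst x = ∫ x, partialDeriv j g x • u x :=
    integral_congr_ae (h.mono fun x hx => congrArg (partialDeriv j g x • ·) hx)
  rw [h3, h2] at h1
  exact (neg_injective h1).symm

/-- Density principle: a closed condition on `H¹₀(Ω)` need only be checked on test functions. -/
theorem H10.mem_of_forall_test {Ω : Set (EuclideanSpace ℝ (Fin d))} {S : Set (H1 d)}
    (hS : IsClosed S) (h : ∀ φ ∈ testFunctions Ω, φ ∈ S) {φ : H1 d} (hφ : φ ∈ H10 Ω) : φ ∈ S := by
  have : φ ∈ closure (testFunctions Ω : Set (H1 d)) := hφ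
  exact closure_minimal h hS this

theorem continuous_fst : Continuous fun φ : H1 d => φ.1.fst :=
  (WithLp.prod_continuous_ofLp 2 _ _).fst.comp continuous_subtype_val

theorem continuous_snd (j : Fin d) : Continuous fun φ : H1 d => φ.1.snd j :=
  (continuous_apply j).comp ((PiLp.continuous_ofLp 2 _).comp
    ((WithLp.prod_continuous_ofLp 2 _ _).snd.comp continuous_subtype_val))

/-- The weak derivatives of an element of `H¹₀(Ω)` vanish almost everywhere outside `Ω`. -/
theorem H10.weakPartial_eq_zero {Ω : Set (EuclideanSpace ℝ (Fin d))} (hΩ : MeasurableSet Ω)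
    {φ : H1 d} (hφ : φ ∈ H10 Ω) (j : Fin d) : ∀ᵐ x, x ∉ Ω → weakPartial φ j x = 0 := by
  -- Vanishing outside `Ω` is the kernel of the continuous restriction to `Ωᶜ`, hence a closed
  -- condition.
  let T := LpToLpRestrictCLM (EuclideanSpace ℝ (Fin d)) ℂ ℝ volume 2 Ωᶜ
  have key : ∀ ψ : H1 d, T (ψ.1.snd j) = 0 ↔ ∀ᵐ x, x ∉ Ω → weakPartial ψ j x = 0 := by
    intro ψ
    have h1 := LpToLpRestrictCLM_coeFn ℝ Ωᶜ (ψ.1.snd j)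
    rw [Lp.eq_zero_iff_ae_eq_zero]
    have h2 : (∀ᵐ x, x ∉ Ω → weakPartial ψ j x = 0) ↔
        ψ.1.snd j =ᵐ[volume.restrict Ωᶜ] (0 : EuclideanSpace ℝ (Fin d) → ℂ) :=
      (ae_restrict_iff' hΩ.compl).symm
    rw [h2]
    exact ⟨fun h => h1.symm.trans h, fun h => h1.trans h⟩
  have hcl : IsClosed {ψ : H1 d | T (ψ.1.snd j) = 0} :=
    isClosed_eq (T.continuous.comp (continuous_snd j)) continuous_const
  refine (key φ).1 (H10.mem_of_forall_test hcl (fun ψ hψ => (key ψ).2 ?_) hφ)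
  obtain ⟨u, hu, hc, hs, hψ⟩ := hψ
  filter_upwards [weakPartial_ae_eq hu hψ j] with x hx hxΩ
  rw [hx, partialDeriv, fderiv_of_notMem_tsupport ℝ (fun h => hxΩ (hs h))]
  rfl

theorem measurableSet_slab [NeZero d] (N : ℕ) : MeasurableSet (slab d N) := by
  have h : Continuous fun x : EuclideanSpace ℝ (Fin d) => x 0 := by fun_prop
  exact ((isOpen_lt continuous_const h).inter (isOpen_lt h continuous_const)).measurableSet

/-! ### Poincaré's inequality in the slab -/

theorem contDiff_norm_sq {u : EuclideanSpace ℝ (Fin d) → ℂ} (hu : ContDiff ℝ ∞ u) :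
    ContDiff ℝ ∞ fun x => ‖u x‖ ^ 2 := hu.norm_sq ℝ

theorem hasCompactSupport_norm_sq {u : EuclideanSpace ℝ (Fin d) → ℂ} (hc : HasCompactSupport u) :
    HasCompactSupport fun x => ‖u x‖ ^ 2 :=
  hc.mono fun x hx h => hx (by simp [h])

theorem integrable_norm_sq {u : EuclideanSpace ℝ (Fin d) → ℂ} (hu : Continuous u)
    (hc : HasCompactSupport u) : Integrable fun x => ‖u x‖ ^ 2 :=
  (hu.norm.pow 2).integrable_of_hasCompactSupport (hasCompactSupport_norm_sq hc)

theorem fderiv_norm_sq_apply {u : EuclideanSpace ℝ (Fin d) → ℂ} (hu : ContDiff ℝ ∞ u)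
    (x v : EuclideanSpace ℝ (Fin d)) :
    fderiv ℝ (fun x => ‖u x‖ ^ 2) x v = 2 * inner ℝ (u x) (fderiv ℝ u x v) := by
  have := ((hu.differentiable (by simp)).differentiableAt (x := x)).hasFDerivAt.norm_sq.fderiv
  rw [this]
  simp
  ring

theorem integrable_coord_mul_partialDeriv (j : Fin d) {w : EuclideanSpace ℝ (Fin d) → ℝ}
    (hw : ContDiff ℝ ∞ w) (hc : HasCompactSupport w) :
    Integrable fun x => x j * partialDeriv j w x :=
  (((EuclideanSpace.proj j : EuclideanSpace ℝ (Fin d) →L[ℝ] ℝ).continuous).mul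
    (continuous_partialDeriv j hw)).integrable_of_hasCompactSupport
      (hasCompactSupport_partialDeriv j hc).mul_left

/-- Integration by parts against `x_j`, whose `j`-th derivative is `1`. With `w = |u|²` and `j = 0`
it is the source of Poincaré's inequality, as `|x_0| ≤ N` on the slab. -/
theorem integral_coord_mul_partialDeriv (j : Fin d) {w : EuclideanSpace ℝ (Fin d) → ℝ}
    (hw : ContDiff ℝ ∞ w) (hc : HasCompactSupport w) :
    ∫ x, x j * partialDeriv j w x = - ∫ x, w x := by
  let X : EuclideanSpace ℝ (Fin d) →L[ℝ] ℝ := EuclideanSpace.proj j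
  have hX : ∀ x, fderiv ℝ X x (EuclideanSpace.single j 1) = 1 := by
    intro x
    rw [X.fderiv]
    simp [X]
  have h := integral_mul_fderiv_eq_neg_fderiv_mul_of_integrable
    (μ := (volume : Measure (EuclideanSpace ℝ (Fin d)))) (𝕜 := ℝ) (f := X)
    (g := w) (v := EuclideanSpace.single j 1)
    (by
      simp only [hX, one_mul]
      exact hw.continuous.integrable_of_hasCompactSupport hc)
    (integrable_coord_mul_partialDeriv j hw hc)
    ((X.continuous.mul hw.continuous).integrable_of_hasCompactSupport hc.mul_left)
    (fun x _ => X.differentiableAt)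
    (fun x _ => (hw.differentiable (by simp)).differentiableAt)
  simp only [hX, one_mul] at h
  exact h

/-- Poincaré's inequality in the slab. -/
theorem poincare_test [NeZero d] {N : ℕ} {u : EuclideanSpace ℝ (Fin d) → ℂ} (hu : ContDiff ℝ ∞ u)
    (hc : HasCompactSupport u) (hs : tsupport u ⊆ slab d N) :
    ∫ x, ‖u x‖ ^ 2 ≤ 4 * (N : ℝ) ^ 2 * ∫ x, ‖partialDeriv 0 u x‖ ^ 2 := by
  have hw := contDiff_norm_sq hu
  have hwc := hasCompactSupport_norm_sq hc
  have hi := integral_coord_mul_partialDeriv 0 hw hwc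
  have i1 := integrable_norm_sq hu.continuous hc
  have i2 := integrable_norm_sq (continuous_partialDeriv' 0 hu)
    (hasCompactSupport_partialDeriv' 0 hc)
  have i3 : Integrable fun x => x 0 * partialDeriv 0 (fun x => ‖u x‖ ^ 2) x :=
    integrable_coord_mul_partialDeriv 0 hw hwc
  have hle : ∫ x, -(x 0 * partialDeriv 0 (fun x => ‖u x‖ ^ 2) x) ≤
      ∫ x, (1 / 2 * ‖u x‖ ^ 2 + 2 * (N : ℝ) ^ 2 * ‖partialDeriv 0 u x‖ ^ 2) := by
    refine integral_mono i3.neg ((i1.const_mul _).add (i2.const_mul _)) fun x => ?_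
    have hd : partialDeriv 0 (fun x => ‖u x‖ ^ 2) x = 2 * inner ℝ (u x) (partialDeriv 0 u x) :=
      fderiv_norm_sq_apply hu x _
    simp only [hd]
    generalize partialDeriv 0 u x = z
    by_cases hx : x ∈ tsupport u
    · have hxN : |x 0| ≤ N := abs_le.2 ⟨(hs hx).1.le, (hs hx).2.le⟩
      have h2 : |x 0 * inner ℝ (u x) z| ≤ N * (‖u x‖ * ‖z‖) := by
        rw [abs_mul]
        exact mul_le_mul hxN (abs_real_inner_le_norm _ _) (abs_nonneg _) (Nat.cast_nonneg _)
      have h3 := neg_abs_le (x 0 * inner ℝ (u x) z)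
      -- Young's inequality, weighted so that half of `‖u‖²` can be absorbed on the left; this
      -- yields the constant `4N²`.
      nlinarith [sq_nonneg (‖u x‖ - 2 * N * ‖z‖)]
    · have h0 : u x = 0 := image_eq_zero_of_notMem_tsupport hx
      simp only [h0, inner_zero_left, mul_zero, neg_zero]
      positivity
  rw [integral_neg, hi, neg_neg, integral_add (i1.const_mul _) (i2.const_mul _),
    integral_const_mul, integral_const_mul] at hle
  linarith

theorem H10.poincare [NeZero d] {N : ℕ} {φ : H1 d} (hφ : φ ∈ H10 (slab d N)) :
    ‖φ.1.fst‖ ^ 2 ≤ 4 * (N : ℝ) ^ 2 * ‖φ.1.snd 0‖ ^ 2 := by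
  have hcl : IsClosed {ψ : H1 d | ‖ψ.1.fst‖ ^ 2 ≤ 4 * (N : ℝ) ^ 2 * ‖ψ.1.snd 0‖ ^ 2} :=
    isClosed_le (continuous_fst.norm.pow 2) (continuous_const.mul ((continuous_snd 0).norm.pow 2))
  refine H10.mem_of_forall_test hcl ?_ hφ
  rintro ψ ⟨u, hu, hc, hs, hψ⟩
  have h := poincare_test hu hc hs
  change ‖ψ.1.fst‖ ^ 2 ≤ 4 * (N : ℝ) ^ 2 * ‖ψ.1.snd 0‖ ^ 2
  rw [L2.norm_sq_eq, L2.norm_sq_eq]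
  have h1 : ∫ x, ‖ψ.1.fst x‖ ^ 2 = ∫ x, ‖u x‖ ^ 2 :=
    integral_congr_ae (hψ.mono fun x hx => congrArg (‖·‖ ^ 2) hx)
  have h2 : ∫ x, ‖ψ.1.snd 0 x‖ ^ 2 = ∫ x, ‖partialDeriv 0 u x‖ ^ 2 :=
    integral_congr_ae ((weakPartial_ae_eq hu hψ 0).mono fun x hx => congrArg (‖·‖ ^ 2) hx)
  rwa [h1, h2]

/-! ### Sobolev inequality -/

/-- The operator norm is at most the Hilbert–Schmidt norm, by Cauchy–Schwarz. It converts the norm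
of the full derivative into the partial derivatives of the `H¹` norm. -/
theorem norm_clm_sq_le (T : EuclideanSpace ℝ (Fin d) →L[ℝ] ℂ) :
    ‖T‖ ^ 2 ≤ ∑ j, ‖T (EuclideanSpace.single j 1)‖ ^ 2 := by
  have h : ‖T‖ ≤ √(∑ j, ‖T (EuclideanSpace.single j 1)‖ ^ 2) := by
    refine T.opNorm_le_bound (Real.sqrt_nonneg _) fun x => ?_
    have hx : T x = ∑ j, x j • T (EuclideanSpace.single j 1) := by
      conv_lhs => rw [← (EuclideanSpace.basisFun (Fin d) ℝ).sum_repr x]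
      simp
    rw [hx, EuclideanSpace.norm_eq, mul_comm]
    refine (norm_sum_le _ _).trans ?_
    simp only [norm_smul]
    exact Real.sum_mul_le_sqrt_mul_sqrt _ _ _
  calc ‖T‖ ^ 2 ≤ √(∑ j, ‖T (EuclideanSpace.single j 1)‖ ^ 2) ^ 2 :=
        pow_le_pow_left₀ (norm_nonneg _) h 2
    _ = _ := Real.sq_sqrt (by positivity)

/-- A Sobolev inequality for smooth compactly supported functions, obtained from the
Gagliardo–Nirenberg inequality for `|u|²`. -/
theorem exists_sobolev_test (hd : 2 ≤ d) : ∃ C : NNReal,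
    ∀ u : EuclideanSpace ℝ (Fin d) → ℂ, ContDiff ℝ ∞ u → HasCompactSupport u →
    ∫⁻ x, ENNReal.ofReal ((‖u x‖ ^ 2) ^ ((d : ℝ) / (d - 1))) ≤
      C * ENNReal.ofReal (∫ x, (‖u x‖ ^ 2 + ∑ j, ‖partialDeriv j u x‖ ^ 2)) ^
        ((d : ℝ) / (d - 1)) := by
  have hd' : (2 : ℝ) ≤ d := by exact_mod_cast hd
  have hq : Real.HolderConjugate (Module.finrank ℝ (EuclideanSpace ℝ (Fin d)))
      ((d : ℝ) / (d - 1)) := by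
    simpa [Real.conjExponent] using Real.HolderConjugate.conjExponent
      (show (1 : ℝ) < d by linarith)
  refine ⟨lintegralPowLePowLIntegralFDerivConst
    (volume : Measure (EuclideanSpace ℝ (Fin d))) ((d : ℝ) / (d - 1)), fun u hu hc => ?_⟩
  have hw := contDiff_norm_sq hu
  have hwc := hasCompactSupport_norm_sq hc
  have h := lintegral_pow_le_pow_lintegral_fderiv volume (hw.of_le (by simp)) hwc hq
  have hint : Integrable fun x => ‖u x‖ ^ 2 + ∑ j, ‖partialDeriv j u x‖ ^ 2 :=
    (integrable_norm_sq hu.continuous hc).add (integrable_finsetSum _ fun j _ =>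
      integrable_norm_sq (continuous_partialDeriv' j hu) (hasCompactSupport_partialDeriv' j hc))
  calc ∫⁻ x, ENNReal.ofReal ((‖u x‖ ^ 2) ^ ((d : ℝ) / (d - 1)))
      = ∫⁻ x, ‖‖u x‖ ^ 2‖ₑ ^ ((d : ℝ) / (d - 1)) := by
        refine lintegral_congr fun x => ?_
        rw [Real.enorm_eq_ofReal (by positivity),
          ENNReal.ofReal_rpow_of_nonneg (by positivity) hq.symm.nonneg]
    _ ≤ _ := h
    _ ≤ _ := by
        gcongr
        · exact hq.symm.nonneg
        rw [ofReal_integral_eq_lintegral_ofReal hint (.of_forall fun x => by positivity)]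
        refine lintegral_mono fun x => ?_
        rw [← ofReal_norm]
        refine ENNReal.ofReal_le_ofReal ?_
        -- `|∇|u|²| ≤ 2|u||∇u| ≤ |u|² + |∇u|²`, whose integral is the squared `H¹` norm.
        have h1 : ‖fderiv ℝ (fun x => ‖u x‖ ^ 2) x‖ ≤ 2 * (‖u x‖ * ‖fderiv ℝ u x‖) := by
          refine ContinuousLinearMap.opNorm_le_bound _ (by positivity) fun v => ?_
          rw [fderiv_norm_sq_apply hu, norm_mul, Real.norm_ofNat]
          calc 2 * ‖inner ℝ (u x) (fderiv ℝ u x v)‖ ≤ 2 * (‖u x‖ * ‖fderiv ℝ u x v‖) := by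
                gcongr; exact norm_inner_le_norm _ _
            _ ≤ 2 * (‖u x‖ * (‖fderiv ℝ u x‖ * ‖v‖)) := by
                gcongr; exact ContinuousLinearMap.le_opNorm _ _
            _ = _ := by ring
        have h2 := norm_clm_sq_le (fderiv ℝ u x)
        simp only [partialDeriv]
        nlinarith [sq_nonneg (‖u x‖ - ‖fderiv ℝ u x‖)]

theorem exists_seq_test_ae_tendsto {Ω : Set (EuclideanSpace ℝ (Fin d))} {φ : H1 d}
    (hφ : φ ∈ H10 Ω) : ∃ s : ℕ → H1 d, (∀ n, s n ∈ testFunctions Ω) ∧ Tendsto s atTop (𝓝 φ) ∧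
      ∀ᵐ x, Tendsto (fun n => toFun (s n) x) atTop (𝓝 (toFun φ x)) := by
  have : φ ∈ closure (testFunctions Ω : Set (H1 d)) := hφ
  obtain ⟨s, hs, hlim⟩ := mem_closure_iff_seq_limit.1 this
  obtain ⟨ns, hns, hae⟩ := (tendstoInMeasure_of_tendsto_Lp
    ((continuous_fst.tendsto φ).comp hlim)).exists_seq_tendsto_ae
  exact ⟨s ∘ ns, fun n => hs _, hlim.comp hns.tendsto_atTop, hae⟩

/-- A Sobolev inequality in `H¹₀(Ω)`. -/
theorem exists_sobolev (hd : 2 ≤ d) : ∃ C : ℝ, 0 ≤ C ∧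
    ∀ (Ω : Set (EuclideanSpace ℝ (Fin d))) (φ : H1 d), φ ∈ H10 Ω →
    Integrable (fun x => (‖toFun φ x‖ ^ 2) ^ ((d : ℝ) / (d - 1))) ∧
    ∫ x, (‖toFun φ x‖ ^ 2) ^ ((d : ℝ) / (d - 1)) ≤ C * (‖φ‖ ^ 2) ^ ((d : ℝ) / (d - 1)) := by
  have hd' : (2 : ℝ) ≤ d := by exact_mod_cast hd
  have hq : 0 ≤ (d : ℝ) / (d - 1) := div_nonneg (by linarith) (by linarith)
  obtain ⟨C, hC⟩ := exists_sobolev_test hd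
  refine ⟨C, C.coe_nonneg, fun Ω φ hφ => ?_⟩
  obtain ⟨s, hs, hlim, hae⟩ := exists_seq_test_ae_tendsto hφ
  have hcont : Continuous fun z : ℂ => (‖z‖ ^ 2) ^ ((d : ℝ) / (d - 1)) :=
    (continuous_norm.pow 2).rpow_const fun _ => Or.inr hq
  have hmeas : ∀ ψ : H1 d, AEStronglyMeasurable
      (fun x => (‖toFun ψ x‖ ^ 2) ^ ((d : ℝ) / (d - 1))) volume := fun ψ =>
    hcont.comp_aestronglyMeasurable (Lp.aestronglyMeasurable ψ.1.fst)
  have hn : ∀ n, ∫⁻ x, ENNReal.ofReal ((‖toFun (s n) x‖ ^ 2) ^ ((d : ℝ) / (d - 1))) ≤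
      ENNReal.ofReal (C * (‖s n‖ ^ 2) ^ ((d : ℝ) / (d - 1))) := by
    intro n
    obtain ⟨u, hu, hc, -, hψ⟩ := hs n
    rw [ENNReal.ofReal_mul C.coe_nonneg, ENNReal.ofReal_coe_nnreal,
      ← ENNReal.ofReal_rpow_of_nonneg (by positivity) hq]
    have h1 : ∫⁻ x, ENNReal.ofReal ((‖toFun (s n) x‖ ^ 2) ^ ((d : ℝ) / (d - 1))) =
        ∫⁻ x, ENNReal.ofReal ((‖u x‖ ^ 2) ^ ((d : ℝ) / (d - 1))) :=
      lintegral_congr_ae (hψ.mono fun x hx => by simp only [hx])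
    have h2 : ‖s n‖ ^ 2 = ∫ x, (‖u x‖ ^ 2 + ∑ j, ‖partialDeriv j u x‖ ^ 2) := by
      rw [H1.norm_sq_eq, L2.norm_sq_eq]
      simp only [L2.norm_sq_eq]
      rw [← integral_finsetSum _ fun j _ => L2.integrable_norm_sq _,
        ← integral_add (L2.integrable_norm_sq _)
          (integrable_finsetSum _ fun j _ => L2.integrable_norm_sq _)]
      refine integral_congr_ae ?_
      filter_upwards [hψ, ae_all_iff.2 (weakPartial_ae_eq hu hψ)] with x hx hx'
      simp only [← hx, ← hx']
      rfl
    rw [h1, h2]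
    exact hC u hu hc
  have hlim' : Tendsto (fun n => ENNReal.ofReal (C * (‖s n‖ ^ 2) ^ ((d : ℝ) / (d - 1)))) atTop
      (𝓝 (ENNReal.ofReal (C * (‖φ‖ ^ 2) ^ ((d : ℝ) / (d - 1))))) :=
    ENNReal.tendsto_ofReal (((hlim.norm.pow 2).rpow_const (Or.inr hq)).const_mul _)
  have hfin : ∫⁻ x, ENNReal.ofReal ((‖toFun φ x‖ ^ 2) ^ ((d : ℝ) / (d - 1))) ≤
      ENNReal.ofReal (C * (‖φ‖ ^ 2) ^ ((d : ℝ) / (d - 1))) := by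
    -- Fatou's lemma along the test functions: it also gives the integrability of the limit, not
    -- known beforehand.
    calc _ = ∫⁻ x, liminf (fun n =>
          ENNReal.ofReal ((‖toFun (s n) x‖ ^ 2) ^ ((d : ℝ) / (d - 1)))) atTop := by
          refine lintegral_congr_ae (hae.mono fun x hx => ?_)
          exact (ENNReal.tendsto_ofReal ((hcont.tendsto _).comp hx)).liminf_eq.symm
      _ ≤ liminf (fun n => ∫⁻ x,
          ENNReal.ofReal ((‖toFun (s n) x‖ ^ 2) ^ ((d : ℝ) / (d - 1)))) atTop :=
          lintegral_liminf_le' fun n => (hmeas (s n)).aemeasurable.ennreal_ofReal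
      _ ≤ liminf (fun n => ENNReal.ofReal (C * (‖s n‖ ^ 2) ^ ((d : ℝ) / (d - 1)))) atTop :=
          liminf_le_liminf (.of_forall hn)
      _ = _ := hlim'.liminf_eq
  have hnn : 0 ≤ᵐ[volume] fun x => (‖toFun φ x‖ ^ 2) ^ ((d : ℝ) / (d - 1)) :=
    .of_forall fun x => by positivity
  refine ⟨⟨hmeas φ, ?_⟩, ?_⟩
  · rw [hasFiniteIntegral_iff_ofReal hnn]
    exact hfin.trans_lt ENNReal.ofReal_lt_top
  · rw [integral_eq_lintegral_of_nonneg_ae hnn (hmeas φ)]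
    exact ENNReal.toReal_le_of_le_ofReal (by positivity) hfin

/-! ### Pointwise lower bounds for the potential -/

theorem neg_le_quintic {A m : ℝ} (hA : 0 ≤ A) (hA1 : A ≤ 1) (hm : 0 ≤ m) :
    -A ≤ (m - 1) ^ 2 * (m - A) := by
  rcases le_total A m with h | h
  · have := mul_nonneg (sq_nonneg (m - 1)) (sub_nonneg.2 h)
    linarith
  · have h1 : (m - 1) ^ 2 ≤ 1 := by nlinarith
    nlinarith [mul_nonneg (sub_nonneg.2 h1) (sub_nonneg.2 h)]

/-- Here `a = Re z`, `n = |z|`, and `|1 + z|² - 1 = 2a + n²`. Young's inequality costs a factor `1 -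
η` in the square, the smallness of `n` costs another in the last factor, and `(1 - η)² ≥ 1 - 2η`.
The error `n⁴` is at most `(n²)^q` because `n ≤ 1` and `q ≤ 2`. -/
theorem quintic_lower_bound_of_le {A η q a n : ℝ} (hA : 0 ≤ A) (hA1 : A < 1) (hη0 : 0 < η)
    (hη1 : η ≤ 1 / 2) (hq : 1 ≤ q) (hq2 : q ≤ 2) (han : |a| ≤ n) (hn : n ≤ η * (1 - A) / 3) :
    4 * (1 - A) * (1 - 2 * η) * a ^ 2 - 1 / η * (n ^ 2) ^ q ≤
      (2 * a + n ^ 2) ^ 2 * (1 + 2 * a + n ^ 2 - A) := by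
  have hA' : 0 < 1 - A := by linarith
  have hzn : 0 ≤ n := (abs_nonneg a).trans han
  have hn1 : n ≤ 1 := hn.trans (by nlinarith)
  have hpow : (n ^ 2) ^ 2 ≤ (n ^ 2) ^ q := by
    rw [← Real.rpow_natCast (n ^ 2) 2]
    rcases hzn.eq_or_lt with h0 | h0
    · subst h0
      rw [show ((0 : ℝ) ^ 2) = 0 by norm_num, Real.zero_rpow (by norm_num),
        Real.zero_rpow (by linarith)]
    · exact Real.rpow_le_rpow_of_exponent_ge (by positivity) (pow_le_one₀ hzn hn1)
        (by exact_mod_cast hq2)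
  have h1 : 4 * (1 - η) * a ^ 2 - 1 / η * (n ^ 2) ^ 2 ≤ (2 * a + n ^ 2) ^ 2 := by
    have h0 : (2 * a + n ^ 2) ^ 2 - (4 * (1 - η) * a ^ 2 - 1 / η * (n ^ 2) ^ 2) =
        η * (2 * a + n ^ 2 / η) ^ 2 + (n ^ 2) ^ 2 := by
      field_simp
      ring
    have : 0 ≤ η * (2 * a + n ^ 2 / η) ^ 2 + (n ^ 2) ^ 2 := by positivity
    linarith
  have h2 : (1 - η) * (1 - A) ≤ 1 + 2 * a + n ^ 2 - A := by
    have := (abs_le.1 han).1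
    nlinarith [sq_nonneg n]
  have h3 : (1 - η) * (1 - A) * (2 * a + n ^ 2) ^ 2 ≤
      (2 * a + n ^ 2) ^ 2 * (1 + 2 * a + n ^ 2 - A) := by
    rw [mul_comm]
    exact mul_le_mul_of_nonneg_left h2 (sq_nonneg _)
  have hB0 : 0 ≤ (1 - η) * (1 - A) := mul_nonneg (by linarith) hA'.le
  have hB1 : (1 - η) * (1 - A) ≤ 1 := mul_le_one₀ (by linarith) hA'.le (by linarith)
  have h4 := mul_le_mul_of_nonneg_left h1 hB0
  have h6 : 4 * (1 - A) * (1 - 2 * η) * a ^ 2 ≤ 4 * (1 - A) * (1 - η) ^ 2 * a ^ 2 := by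
    gcongr
    linarith [sq_nonneg η]
  have h7 : (1 - η) * (1 - A) * (1 / η * (n ^ 2) ^ 2) ≤ 1 / η * (n ^ 2) ^ q := by
    calc _ ≤ 1 * (1 / η * (n ^ 2) ^ 2) := by gcongr
      _ ≤ _ := by rw [one_mul]; gcongr
  linarith

/-- Away from `z = 0` the power `(n²/δ²)^q` dominates both `n²` and `1`: four copies pay for the
quadratic form and the fifth for `A`. -/
theorem quadratic_le_rpow_of_lt {A θ δ q a n : ℝ} (hA : 0 ≤ A) (hA1 : A < 1) (hθ : 0 ≤ θ)
    (hθ1 : θ < 1) (hδ0 : 0 < δ) (hδ1 : δ ≤ 1) (hq : 1 ≤ q) (han : |a| ≤ n) (hn : δ < n) :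
    4 * (1 - A) * θ * a ^ 2 - 5 / (δ ^ 2) ^ q * (n ^ 2) ^ q ≤ -A := by
  have hre : a ^ 2 ≤ n ^ 2 := by
    rw [← sq_abs]
    exact pow_le_pow_left₀ (abs_nonneg _) han 2
  have h1 : 1 ≤ n ^ 2 / δ ^ 2 := by
    rw [one_le_div (by positivity)]
    exact pow_le_pow_left₀ hδ0.le hn.le 2
  have h2 : n ^ 2 ≤ (n ^ 2 / δ ^ 2) ^ q := by
    calc n ^ 2 ≤ n ^ 2 / δ ^ 2 :=
          le_div_self (sq_nonneg n) (by positivity) (pow_le_one₀ hδ0.le hδ1)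
      _ = (n ^ 2 / δ ^ 2) ^ (1 : ℝ) := (Real.rpow_one _).symm
      _ ≤ _ := Real.rpow_le_rpow_of_exponent_le h1 hq
  have h3 : 1 ≤ (n ^ 2 / δ ^ 2) ^ q := Real.one_le_rpow h1 (by linarith)
  have h4 : 5 / (δ ^ 2) ^ q * (n ^ 2) ^ q = 5 * (n ^ 2 / δ ^ 2) ^ q := by
    rw [Real.div_rpow (by positivity) (by positivity)]; ring
  have h5 : (1 - A) * θ * a ^ 2 ≤ a ^ 2 :=
    mul_le_of_le_one_left (sq_nonneg a) (mul_le_one₀ (by linarith) hθ hθ1.le)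
  rw [h4]
  linarith

/-- Up to a superquadratic term, the potential is bounded below by any quadratic form strictly
below its Hessian at `1`. -/
theorem exists_quintic_lower_bound {A θ q : ℝ} (hA : 0 ≤ A) (hA1 : A < 1) (hθ : 0 ≤ θ)
    (hθ1 : θ < 1) (hq : 1 ≤ q) (hq2 : q ≤ 2) : ∃ C : ℝ, 0 ≤ C ∧ ∀ z : ℂ,
    4 * (1 - A) * θ * z.re ^ 2 - C * (‖z‖ ^ 2) ^ q ≤
      (‖1 + z‖ ^ 2 - 1) ^ 2 * (‖1 + z‖ ^ 2 - A) := by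
  have hη0 : 0 < (1 - θ) / 2 := by linarith
  have hη1 : (1 - θ) / 2 ≤ 1 / 2 := by linarith
  have hθη : θ = 1 - 2 * ((1 - θ) / 2) := by ring
  generalize (1 - θ) / 2 = η at *
  have hA' : 0 < 1 - A := by linarith
  have hδ0 : 0 < η * (1 - A) / 3 := by positivity
  have hδ1 : η * (1 - A) / 3 ≤ 1 := by nlinarith
  refine ⟨5 / ((η * (1 - A) / 3) ^ 2) ^ q + 1 / η, by positivity, fun z => ?_⟩
  have hs1 : ‖1 + z‖ ^ 2 = 1 + 2 * z.re + ‖z‖ ^ 2 := by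
    rw [Complex.sq_norm, Complex.sq_norm, Complex.normSq_apply, Complex.normSq_apply]
    simp only [Complex.add_re, Complex.one_re, Complex.add_im, Complex.one_im]
    ring
  have h0 : 0 ≤ (‖z‖ ^ 2) ^ q := by positivity
  rw [add_mul]
  -- Taylor regime for small `z`; beyond it, the global lower bound `-A` suffices. The constant is
  -- the sum of those for the two regimes.
  rcases le_or_gt ‖z‖ (η * (1 - A) / 3) with hn | hn
  · have h1 := quintic_lower_bound_of_le hA hA1 hη0 hη1 hq hq2 (Complex.abs_re_le_norm z) hn
    have h2 : 0 ≤ 5 / ((η * (1 - A) / 3) ^ 2) ^ q * (‖z‖ ^ 2) ^ q := by positivity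
    rw [← hθη] at h1
    rw [hs1, show 1 + 2 * z.re + ‖z‖ ^ 2 - 1 = 2 * z.re + ‖z‖ ^ 2 by ring]
    linarith
  · have h1 := quadratic_le_rpow_of_lt hA hA1 hθ hθ1 hδ0 hδ1 hq (Complex.abs_re_le_norm z) hn
    have h2 : 0 ≤ 1 / η * (‖z‖ ^ 2) ^ q := by positivity
    have h3 := neg_le_quintic hA hA1.le (sq_nonneg ‖1 + z‖)
    linarith

/-! ### Coercivity of the action and the mountain-pass barrier -/

theorem integral_linear_combination_mono {α : Type*} {_ : MeasurableSpace α} {ν : Measure α}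
    {G P M S : α → ℝ} (hG : Integrable G ν) (hP : Integrable P ν) (hM : Integrable M ν)
    (hS : Integrable S ν) {a b e f c : ℝ}
    (h : ∀ x, a * G x - b * S x ≤ e * G x + f * P x + c * M x) :
    a * (∫ x, G x ∂ν) - b * (∫ x, S x ∂ν) ≤
      e * (∫ x, G x ∂ν) + f * (∫ x, P x ∂ν) + c * ∫ x, M x ∂ν := by
  have hle := integral_mono ((hG.const_mul a).sub (hS.const_mul b))
    (((hG.const_mul e).add (hP.const_mul f)).add (hM.const_mul c)) h
  rw [integral_sub' (hG.const_mul a) (hS.const_mul b),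
    integral_add' ((hG.const_mul e).add (hP.const_mul f)) (hM.const_mul c),
    integral_add' (hG.const_mul e) (hP.const_mul f)] at hle
  simpa only [integral_const_mul] using hle

theorem integrable_weakPartial_norm_sq (φ : H1 d) :
    Integrable fun x => ∑ j, ‖weakPartial φ j x‖ ^ 2 :=
  integrable_finsetSum _ fun j _ => L2.integrable_norm_sq (φ.1.snd j)

theorem integral_weakPartial_norm_sq (φ : H1 d) :
    ∫ x, ∑ j, ‖weakPartial φ j x‖ ^ 2 = ∑ j, ‖φ.1.snd j‖ ^ 2 := by
  simp only [L2.norm_sq_eq]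
  exact integral_finsetSum _ fun j _ => L2.integrable_norm_sq (φ.1.snd j)

theorem integrable_momentum_density [NeZero d] (φ : H1 d) :
    Integrable fun x => (weakPartial φ 0 x).im * ((onePlus φ x).re - 1) := by
  have h1 : MemLp (fun x => (φ.1.snd 0 x).im) 2 volume := (Lp.memLp (φ.1.snd 0)).im
  have h2 : MemLp (fun x => (φ.1.fst x).re) 2 volume := (Lp.memLp φ.1.fst).re
  refine (h1.integrable_mul h2).congr (.of_forall fun x => ?_)
  simp [onePlus, toFun, weakPartial]

theorem action_eq_of_integrableOn [NeZero d] {A : ℝ} {N : ℕ} {φ : H1 d}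
    (h : IntegrableOn (potential A φ) (slab d N)) (c : ℝ) :
    action A c N φ = ((1 / 2 * (∫ x in slab d N, ∑ j, ‖weakPartial φ j x‖ ^ 2)
      + 1 / 2 * (∫ x in slab d N, potential A φ x)
      + c * ∫ x in slab d N, (weakPartial φ 0 x).im * ((onePlus φ x).re - 1) : ℝ) : EReal) := by
  rw [action, energy, if_pos h, momentum, ← EReal.coe_sub]
  congr 1
  ring

theorem action_eq_top_of_not_integrableOn [NeZero d] {A : ℝ} {N : ℕ} {φ : H1 d}
    (h : ¬ IntegrableOn (potential A φ) (slab d N)) (c : ℝ) : action A c N φ = ⊤ := by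
  rw [action, energy, if_neg h, EReal.top_sub_coe]

/-- Subsonic coercivity of the action near the constant state `1`. -/
theorem exists_action_lower_bound [NeZero d] (hd : 2 ≤ d) {A c : ℝ} (hA : 0 ≤ A) (hA1 : A < 1)
    (hc : c ^ 2 < 4 * (1 - A)) (N : ℕ) : ∃ κ C : ℝ, 0 < κ ∧ 0 ≤ C ∧
    ∀ φ ∈ H10 (slab d N),
      ((κ * ‖φ‖ ^ 2 - C * (‖φ‖ ^ 2) ^ ((d : ℝ) / (d - 1)) : ℝ) : EReal) ≤ action A c N φ := by
  have hd' : (2 : ℝ) ≤ d := by exact_mod_cast hd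
  have hA' : 0 < 4 * (1 - A) := by linarith
  -- Midpoint of `c²/(4(1 - A))` and `1`, so that `m` below lies strictly between `c²` and `4(1 -
  -- A)`.
  set θ := (1 + c ^ 2 / (4 * (1 - A))) / 2 with hθ
  have hr : c ^ 2 / (4 * (1 - A)) < 1 := (div_lt_one hA').2 hc
  have hr0 : 0 ≤ c ^ 2 / (4 * (1 - A)) := by positivity
  have hθ0 : 0 < θ := by rw [hθ]; linarith
  have hθ1 : θ < 1 := by rw [hθ]; linarith
  set m := 4 * (1 - A) * θ with hm
  have hm0 : 0 < m := by positivity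
  have hcm : c ^ 2 < m := by
    have : m = (4 * (1 - A) + c ^ 2) / 2 := by
      rw [hm, hθ, mul_div_assoc', mul_add, mul_one, mul_div_cancel₀ _ hA'.ne']
    linarith
  obtain ⟨C₁, hC₁, hpot⟩ := exists_quintic_lower_bound (q := (d : ℝ) / (d - 1)) hA hA1 hθ0.le hθ1
    (by rw [one_le_div (by linarith)]; linarith) (by rw [div_le_iff₀ (by linarith)]; linarith)
  obtain ⟨C₂, hC₂, hsob⟩ := exists_sobolev hd
  -- The fraction of the gradient left after `c b a` is absorbed by `m a²/2 + c² b²/(2m)`.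
  set μ := 1 / 2 * (1 - c ^ 2 / m) with hμ
  have hμ0 : 0 < μ := by
    have : c ^ 2 / m < 1 := (div_lt_one hm0).2 hcm
    rw [hμ]; linarith
  refine ⟨μ / (4 * (N : ℝ) ^ 2 + 1), 1 / 2 * C₁ * C₂, by positivity, by positivity,
    fun φ hφ => ?_⟩
  by_cases hint : IntegrableOn (potential A φ) (slab d N)
  swap
  · rw [action_eq_top_of_not_integrableOn hint]
    exact le_top
  rw [action_eq_of_integrableOn hint, EReal.coe_le_coe_iff]
  obtain ⟨hsi, hsb⟩ := hsob _ φ hφ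
  have hG := integrable_weakPartial_norm_sq φ
  have hM := integrable_momentum_density φ
  have hfull : ∫ x in slab d N, ∑ j, ‖weakPartial φ j x‖ ^ 2 = ∑ j, ‖φ.1.snd j‖ ^ 2 := by
    rw [← integral_weakPartial_norm_sq]
    refine setIntegral_eq_integral_of_ae_compl_eq_zero ?_
    filter_upwards [ae_all_iff.2 (H10.weakPartial_eq_zero (measurableSet_slab N) hφ)] with x hx hxN
    exact Finset.sum_eq_zero fun j _ => by rw [hx j hxN]; simp
  have hpt : ∀ x, μ * ∑ j, ‖weakPartial φ j x‖ ^ 2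
      - 1 / 2 * C₁ * (‖toFun φ x‖ ^ 2) ^ ((d : ℝ) / (d - 1)) ≤
      1 / 2 * ∑ j, ‖weakPartial φ j x‖ ^ 2 + 1 / 2 * potential A φ x
        + c * ((weakPartial φ 0 x).im * ((onePlus φ x).re - 1)) := by
    intro x
    have h1 := hpot (toFun φ x)
    have h2 : (weakPartial φ 0 x).im ^ 2 ≤ ∑ j, ‖weakPartial φ j x‖ ^ 2 := by
      calc (weakPartial φ 0 x).im ^ 2 ≤ ‖weakPartial φ 0 x‖ ^ 2 := by
            rw [← sq_abs]
            exact pow_le_pow_left₀ (abs_nonneg _) (Complex.abs_im_le_norm _) 2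
        _ ≤ _ := Finset.single_le_sum (f := fun j => ‖weakPartial φ j x‖ ^ 2)
            (fun j _ => by positivity) (Finset.mem_univ 0)
    have h3 : (onePlus φ x).re - 1 = (toFun φ x).re := by simp [onePlus]
    rw [h3]
    change _ ≤ _ + 1 / 2 * ((‖1 + toFun φ x‖ ^ 2 - 1) ^ 2 * (‖1 + toFun φ x‖ ^ 2 - A)) + _
    generalize ∑ j, ‖weakPartial φ j x‖ ^ 2 = G at *
    generalize (weakPartial φ 0 x).im = b at *
    generalize (toFun φ x).re = a at *
    have h4 : 0 ≤ 1 / 2 * m * a ^ 2 + 1 / 2 * (c ^ 2 / m) * b ^ 2 + c * (b * a) := by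
      have : 1 / 2 * m * a ^ 2 + 1 / 2 * (c ^ 2 / m) * b ^ 2 + c * (b * a) =
          1 / 2 * m * (a + c * b / m) ^ 2 := by
        field_simp
        ring
      rw [this]
      positivity
    have h5 : 1 / 2 * (c ^ 2 / m) * b ^ 2 ≤ 1 / 2 * (c ^ 2 / m) * G := by gcongr
    have h6 : μ * G = 1 / 2 * G - 1 / 2 * (c ^ 2 / m) * G := by rw [hμ]; ring
    rw [h6]
    linarith
  have hle := integral_linear_combination_mono hG.integrableOn hint hM.integrableOn
    hsi.integrableOn hpt (ν := volume.restrict (slab d N))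
  refine le_trans ?_ hle
  rw [hfull]
  have h7 : ∫ x in slab d N, (‖toFun φ x‖ ^ 2) ^ ((d : ℝ) / (d - 1)) ≤
      C₂ * (‖φ‖ ^ 2) ^ ((d : ℝ) / (d - 1)) :=
    (setIntegral_le_integral hsi (.of_forall fun x => by positivity)).trans hsb
  -- By Poincaré, `‖φ‖²` is at most `4N² + 1` times the squared norm of the gradient.
  have h8 : μ / (4 * (N : ℝ) ^ 2 + 1) * ‖φ‖ ^ 2 ≤ μ * ∑ j, ‖φ.1.snd j‖ ^ 2 := by
    rw [div_mul_eq_mul_div, div_le_iff₀ (by positivity), mul_assoc μ]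
    refine mul_le_mul_of_nonneg_left ?_ hμ0.le
    have hp := H10.poincare hφ
    have h0 : ‖φ.1.snd 0‖ ^ 2 ≤ ∑ j, ‖φ.1.snd j‖ ^ 2 :=
      Finset.single_le_sum (f := fun j => ‖φ.1.snd j‖ ^ 2) (fun j _ => by positivity)
        (Finset.mem_univ 0)
    have h0' := mul_le_mul_of_nonneg_left h0 (by positivity : 0 ≤ 4 * (N : ℝ) ^ 2)
    rw [H1.norm_sq_eq]
    linarith
  have h9 := mul_le_mul_of_nonneg_left h7 (by positivity : 0 ≤ 1 / 2 * C₁)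
  linarith

/-- Since `q > 1`, the term `(‖φ‖²)^q` is `o(‖φ‖²)` and costs at most half of `κ` on a small ball.
-/
theorem exists_action_barrier [NeZero d] (hd : 2 ≤ d) {A c : ℝ} (hA : 0 ≤ A) (hA1 : A < 1)
    (hc : c ^ 2 < 4 * (1 - A)) (N : ℕ) : ∃ κ ρ : ℝ, 0 < κ ∧ 0 < ρ ∧
    ∀ φ ∈ H10 (slab d N), ‖φ‖ ≤ ρ → ((κ * ‖φ‖ ^ 2 : ℝ) : EReal) ≤ action A c N φ := by
  have hd' : (2 : ℝ) ≤ d := by exact_mod_cast hd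
  obtain ⟨κ, C, hκ, hC, h⟩ := exists_action_lower_bound hd hA hA1 hc N
  set q := (d : ℝ) / (d - 1) with hq
  have hq1 : 0 < q - 1 := by
    have : 1 < q := by rw [hq, one_lt_div (by linarith)]; linarith
    linarith
  have hlim : Tendsto (fun r : ℝ => C * (r ^ 2) ^ (q - 1)) (𝓝 0) (𝓝 0) := by
    have : Continuous fun r : ℝ => C * (r ^ 2) ^ (q - 1) :=
      continuous_const.mul ((continuous_id.pow 2).rpow_const fun _ => Or.inr hq1.le)
    simpa [Real.zero_rpow hq1.ne'] using this.tendsto 0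
  obtain ⟨ρ, hρ, hρ'⟩ := Metric.eventually_nhds_iff.1
    (hlim.eventually (gt_mem_nhds (show 0 < κ / 2 by linarith)))
  refine ⟨κ / 2, ρ / 2, by linarith, by linarith, fun φ hφ hn => le_trans ?_ (h φ hφ)⟩
  rw [EReal.coe_le_coe_iff]
  have h1 := hρ' (y := ‖φ‖) (by
    rw [dist_zero_right, norm_norm]
    linarith)
  have h2 : (‖φ‖ ^ 2) ^ q = ‖φ‖ ^ 2 * (‖φ‖ ^ 2) ^ (q - 1) := by
    rcases (norm_nonneg φ).eq_or_lt with h0 | h0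
    · rw [← h0, zero_pow two_ne_zero, zero_mul, Real.zero_rpow (by linarith)]
    · rw [Real.rpow_sub_one (by positivity)]
      field_simp
  rw [h2]
  nlinarith [mul_le_mul_of_nonneg_left h1.le (sq_nonneg ‖φ‖)]

/-- Negative action puts `φ₀` outside the ball of radius `ρ`, so by the intermediate value theorem
every path meets its sphere, where the action is at least `κρ²`. These constants may depend on `N`
and `c`, since only positivity is claimed. -/
theorem mountainPassLevel_pos [NeZero d] (hd : 2 ≤ d) {A c : ℝ} (hA : 0 ≤ A) (hA1 : A < 1)
    (hc : c ^ 2 < 4 * (1 - A)) {N : ℕ} {φ₀ : H1 d} (hφ₀ : φ₀ ∈ H10 (slab d N))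
    (hneg : action A c N φ₀ < 0) : 0 < mountainPassLevel A c N φ₀ := by
  obtain ⟨κ, ρ, hκ, hρ, h⟩ := exists_action_barrier hd hA hA1 hc N
  have hbig : ρ < ‖φ₀‖ := by
    by_contra! hle
    refine absurd ((h φ₀ hφ₀ hle).trans_lt hneg) (not_lt.2 ?_)
    exact_mod_cast (by positivity : 0 ≤ κ * ‖φ₀‖ ^ 2)
  refine lt_of_lt_of_le (b := ((κ * ρ ^ 2 : ℝ) : EReal))
    (by exact_mod_cast (by positivity : 0 < κ * ρ ^ 2)) ?_
  refine le_iInf₂ fun g hg => ?_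
  obtain ⟨hgm, hg0, hg1⟩ := hg
  obtain ⟨t, ht⟩ := mem_range_of_exists_le_of_exists_ge (f := fun t => ‖g t‖) (c := ρ)
    g.continuous.norm ⟨0, by simp [hg0, hρ.le]⟩ ⟨1, by simpa only [hg1] using hbig.le⟩
  have hle := h (g t) (hgm t) (le_of_eq ht)
  simp only at ht
  rw [ht] at hle
  exact hle.trans (le_iSup (fun t => action A c N (g t)) t)

/-! ### Real profiles and the upper bound along a segment -/

/-- The potential along the real profiles `ψ = 1 - s`. -/
def realPotential (A s : ℝ) : ℝ := ((1 - s) ^ 2 - 1) ^ 2 * ((1 - s) ^ 2 - A)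

theorem continuous_realPotential (A : ℝ) : Continuous (realPotential A) := by
  unfold realPotential
  fun_prop

@[simp]
theorem realPotential_zero (A : ℝ) : realPotential A 0 = 0 := by simp [realPotential]

@[simp]
theorem realPotential_one (A : ℝ) : realPotential A 1 = -A := by simp [realPotential]

theorem realPotential_le_one {A s : ℝ} (hA : 0 ≤ A) (hs : s ∈ Set.Icc (0 : ℝ) 1) :
    realPotential A s ≤ 1 := by
  have h0 : 0 ≤ (1 - s) ^ 2 := sq_nonneg _
  have h1 : (1 - s) ^ 2 ≤ 1 := pow_le_one₀ (by linarith [hs.2]) (by linarith [hs.1])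
  rw [realPotential]
  generalize (1 - s) ^ 2 = m at *
  have h2 : (m - 1) ^ 2 ≤ 1 := by nlinarith
  calc (m - 1) ^ 2 * (m - A) ≤ (m - 1) ^ 2 * 1 :=
        mul_le_mul_of_nonneg_left (by linarith) (sq_nonneg _)
    _ ≤ 1 := by linarith

theorem integrable_realPotential_comp {A : ℝ} {f : EuclideanSpace ℝ (Fin d) → ℝ}
    (hf : Continuous f) (hc : HasCompactSupport f) : Integrable fun x => realPotential A (f x) :=
  ((continuous_realPotential A).comp hf).integrable_of_hasCompactSupport
    (hc.comp_left (realPotential_zero A))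

theorem contDiff_neg_ofReal {f : EuclideanSpace ℝ (Fin d) → ℝ} (hf : ContDiff ℝ ∞ f) :
    ContDiff ℝ ∞ fun x => -(f x : ℂ) :=
  (Complex.ofRealCLM.contDiff.comp hf).neg

theorem hasCompactSupport_neg_ofReal {f : EuclideanSpace ℝ (Fin d) → ℝ}
    (hc : HasCompactSupport f) : HasCompactSupport fun x => -(f x : ℂ) :=
  hc.mono fun x hx h => hx (by simp [h])

theorem partialDeriv_neg_ofReal {f : EuclideanSpace ℝ (Fin d) → ℝ} (hf : ContDiff ℝ ∞ f)
    (j : Fin d) (x : EuclideanSpace ℝ (Fin d)) :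
    partialDeriv j (fun x => -(f x : ℂ)) x = -((partialDeriv j f x : ℝ) : ℂ) := by
  have h := (Complex.ofRealCLM.hasFDerivAt.comp x
    ((hf.differentiable (by simp)).differentiableAt (x := x)).hasFDerivAt).neg.fderiv
  have h' : fderiv ℝ (fun x => -(f x : ℂ)) x = -(Complex.ofRealCLM ∘SL fderiv ℝ f x) := h
  simp [partialDeriv, h']

/-- The action of a real profile `ψ = 1 - f` supported in the slab: the momentum vanishes. -/
theorem action_eq_of_real [NeZero d] {A : ℝ} {N : ℕ} {φ : H1 d} (c : ℝ)
    {f : EuclideanSpace ℝ (Fin d) → ℝ} (hf : ContDiff ℝ ∞ f) (hc : HasCompactSupport f)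
    (hs : tsupport f ⊆ slab d N) (hφ : toFun φ =ᵐ[volume] fun x => -(f x : ℂ)) :
    action A c N φ = ((1 / 2 * (∫ x, ∑ j, partialDeriv j f x ^ 2)
      + 1 / 2 * (∫ x, realPotential A (f x)) : ℝ) : EReal) := by
  have hw : ∀ᵐ x, ∀ j, weakPartial φ j x = -((partialDeriv j f x : ℝ) : ℂ) := by
    filter_upwards [ae_all_iff.2 (weakPartial_ae_eq (contDiff_neg_ofReal hf) hφ)] with x hx j
    rw [hx j, partialDeriv_neg_ofReal hf]
  have hpot : potential A φ =ᵐ[volume] fun x => realPotential A (f x) := by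
    filter_upwards [hφ] with x hx
    rw [potential, onePlus, hx, ← sub_eq_add_neg, realPotential, ← Complex.ofReal_one,
      ← Complex.ofReal_sub, Complex.norm_real, Real.norm_eq_abs, sq_abs]
  have hint : Integrable (potential A φ) :=
    (integrable_realPotential_comp hf.continuous hc).congr hpot.symm
  have h1 : ∫ x in slab d N, ∑ j, ‖weakPartial φ j x‖ ^ 2 = ∫ x, ∑ j, partialDeriv j f x ^ 2 := by
    rw [← setIntegral_eq_integral_of_forall_compl_eq_zero
      (s := slab d N) (f := fun x => ∑ j, partialDeriv j f x ^ 2)]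
    · refine integral_congr_ae (ae_restrict_of_ae (hw.mono fun x hx => ?_))
      simp [hx]
    · intro x hx
      refine Finset.sum_eq_zero fun j _ => ?_
      rw [partialDeriv, fderiv_of_notMem_tsupport ℝ (fun h => hx (hs h))]
      simp
  have h2 : ∫ x in slab d N, potential A φ x = ∫ x, realPotential A (f x) := by
    rw [← setIntegral_eq_integral_of_forall_compl_eq_zero
      (s := slab d N) (f := fun x => realPotential A (f x))]
    · exact integral_congr_ae (ae_restrict_of_ae hpot)
    · intro x hx
      rw [image_eq_zero_of_notMem_tsupport (fun h => hx (hs h)), realPotential_zero]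
  have h3 : ∫ x in slab d N, (weakPartial φ 0 x).im * ((onePlus φ x).re - 1) = 0 :=
    integral_eq_zero_of_ae (ae_restrict_of_ae (hw.mono fun x hx => by simp [hx]))
  rw [action_eq_of_integrableOn hint.integrableOn, h1, h2, h3, mul_zero, add_zero]

/-- Along the segment `1 - t f`, the gradient term carries a factor `t² ≤ 1`, and the potential is
at most `1` on the support of `f` and zero off it. The bound involves neither `N` nor `c`. -/
theorem mountainPassLevel_le_of_real [NeZero d] {A : ℝ} (hA : 0 ≤ A) {N : ℕ} (c : ℝ)
    {f : EuclideanSpace ℝ (Fin d) → ℝ} (hf : ContDiff ℝ ∞ f) (hc : HasCompactSupport f)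
    (hs : tsupport f ⊆ slab d N) (h01 : ∀ x, f x ∈ Set.Icc (0 : ℝ) 1) {φ : H1 d}
    (hφm : φ ∈ H10 (slab d N)) (hφ : toFun φ =ᵐ[volume] fun x => -(f x : ℂ)) :
    mountainPassLevel A c N φ ≤ ((1 / 2 * (∫ x, ∑ j, partialDeriv j f x ^ 2)
      + 1 / 2 * volume.real (tsupport f) : ℝ) : EReal) := by
  let g : C(unitInterval, H1 d) := ⟨fun t => ((t : ℝ) : ℂ) • φ, by fun_prop⟩
  have hg : g ∈ paths N φ := by
    refine ⟨fun t => (H10 (slab d N)).smul_mem _ hφm, ?_, ?_⟩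
    · exact (congrArg (· • φ) Complex.ofReal_zero).trans (zero_smul ℂ φ)
    · exact (congrArg (· • φ) Complex.ofReal_one).trans (one_smul ℂ φ)
  refine (iInf₂_le g hg).trans (iSup_le fun t => ?_)
  have ht0 : (0 : ℝ) ≤ t := t.2.1
  have ht1 : (t : ℝ) ≤ 1 := t.2.2
  have htf : ContDiff ℝ ∞ fun x => (t : ℝ) * f x := contDiff_const.mul hf
  have htc : HasCompactSupport fun x => (t : ℝ) * f x := hc.mul_left
  have hts : tsupport (fun x => (t : ℝ) * f x) ⊆ slab d N := tsupport_mul_subset_right.trans hs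
  have htφ : toFun (g t) =ᵐ[volume] fun x => -(((t : ℝ) * f x : ℝ) : ℂ) := by
    filter_upwards [Lp.coeFn_smul ((t : ℝ) : ℂ) φ.1.fst, hφ] with x hx hx'
    refine hx.trans ?_
    rw [Pi.smul_apply, show φ.1.fst x = _ from hx']
    simp
  rw [action_eq_of_real c htf htc hts htφ, EReal.coe_le_coe_iff]
  have hpd : ∀ x, ∀ j, partialDeriv j (fun x => (t : ℝ) * f x) x = t * partialDeriv j f x := by
    intro x j
    simp only [partialDeriv]
    rw [fderiv_const_mul (hf.differentiable (by simp)).differentiableAt]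
    simp
  have h1 : ∫ x, ∑ j, partialDeriv j (fun x => (t : ℝ) * f x) x ^ 2 ≤
      ∫ x, ∑ j, partialDeriv j f x ^ 2 := by
    simp only [hpd, mul_pow, ← Finset.mul_sum]
    rw [integral_const_mul]
    exact mul_le_of_le_one_left (integral_nonneg fun x => by positivity) (pow_le_one₀ ht0 ht1)
  have h2 : ∫ x, realPotential A (t * f x) ≤ volume.real (tsupport f) := by
    calc ∫ x, realPotential A (t * f x) ≤ ∫ x, (tsupport f).indicator 1 x := by
          refine integral_mono (integrable_realPotential_comp htf.continuous htc)
            ((integrable_indicator_iff (isClosed_tsupport f).measurableSet).2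
              (integrableOn_const hc.isCompact.measure_lt_top.ne)) fun x => ?_
          by_cases hx : x ∈ tsupport f
          · rw [Set.indicator_of_mem hx]
            exact realPotential_le_one hA ⟨mul_nonneg ht0 (h01 x).1,
              mul_le_one₀ ht1 (h01 x).1 (h01 x).2⟩
          · rw [Set.indicator_of_notMem hx]
            simp [image_eq_zero_of_notMem_tsupport hx]
      _ = _ := integral_indicator_one (isClosed_tsupport f).measurableSet
  linarith

/-! ### A real profile of negative energy -/

/-- A bump equal to `1` on the unit ball contributes `-A` there and at most `1` on the shell up to
radius `r`; the shell is too thin to compensate once `r^d < 1 + A`. -/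
theorem exists_bump_integral_realPotential_neg {A : ℝ} (hA : 0 < A) :
    ∃ b : ContDiffBump (0 : EuclideanSpace ℝ (Fin d)), ∫ x, realPotential A (b x) < 0 := by
  have hlim : Tendsto (fun r : ℝ => r ^ d) (𝓝[>] 1) (𝓝 1) := by
    simpa using ((continuous_pow d).tendsto (1 : ℝ)).mono_left nhdsWithin_le_nhds
  obtain ⟨r, hr1, hr⟩ := ((hlim.eventually (gt_mem_nhds (show (1 : ℝ) < 1 + A by linarith))).and
    self_mem_nhdsWithin).exists
  have hr : 1 < r := hr
  let b : ContDiffBump (0 : EuclideanSpace ℝ (Fin d)) := ⟨1, r, one_pos, hr⟩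
  refine ⟨b, ?_⟩
  have hi : ∀ s : ℝ, Integrable ((Metric.closedBall (0 : EuclideanSpace ℝ (Fin d)) s).indicator
      (1 : EuclideanSpace ℝ (Fin d) → ℝ)) := fun s =>
    (integrable_indicator_iff Metric.isClosed_closedBall.measurableSet).2
      (integrableOn_const (isCompact_closedBall _ _).measure_lt_top.ne)
  have hv : 0 < volume.real (Metric.ball (0 : EuclideanSpace ℝ (Fin d)) 1) :=
    ENNReal.toReal_pos (Metric.measure_ball_pos _ _ one_pos).ne' measure_ball_lt_top.ne
  calc ∫ x, realPotential A (b x) ≤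
      ∫ x, ((Metric.closedBall (0 : EuclideanSpace ℝ (Fin d)) r).indicator 1 x
        - (1 + A) * (Metric.closedBall (0 : EuclideanSpace ℝ (Fin d)) 1).indicator 1 x) := by
        refine integral_mono (integrable_realPotential_comp b.continuous b.hasCompactSupport)
          ((hi r).sub ((hi 1).const_mul _)) fun x => ?_
        simp only
        by_cases h1 : x ∈ Metric.closedBall (0 : EuclideanSpace ℝ (Fin d)) 1
        · rw [Set.indicator_of_mem h1,
            Set.indicator_of_mem (Metric.closedBall_subset_closedBall hr.le h1),
            b.one_of_mem_closedBall h1, realPotential_one]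
          simp
        · rw [Set.indicator_of_notMem h1, mul_zero, sub_zero]
          by_cases h2 : x ∈ Metric.closedBall (0 : EuclideanSpace ℝ (Fin d)) r
          · rw [Set.indicator_of_mem h2]
            exact realPotential_le_one hA.le ⟨b.nonneg, b.le_one⟩
          · rw [Set.indicator_of_notMem h2, b.zero_of_le_dist, realPotential_zero]
            exact (not_le.1 h2).le
    _ = (r ^ d - (1 + A)) * volume.real (Metric.ball (0 : EuclideanSpace ℝ (Fin d)) 1) := by
        rw [integral_sub (hi r) ((hi 1).const_mul _), integral_const_mul,
          integral_indicator_one Metric.isClosed_closedBall.measurableSet,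
          integral_indicator_one Metric.isClosed_closedBall.measurableSet,
          Measure.addHaar_real_closedBall _ _ (by linarith),
          Measure.addHaar_real_closedBall _ _ zero_le_one]
        simp
        ring
    _ < 0 := mul_neg_of_neg_of_pos (by linarith) hv

/-- A large ball of the vacuum `ψ = 0` has negative energy. -/
theorem exists_profile_energy_neg {A : ℝ} (hA : 0 < A) :
    ∃ f : EuclideanSpace ℝ (Fin d) → ℝ, ContDiff ℝ ∞ f ∧ HasCompactSupport f ∧
      (∀ x, f x ∈ Set.Icc (0 : ℝ) 1) ∧
      1 / 2 * (∫ x, ∑ j, partialDeriv j f x ^ 2) + 1 / 2 * (∫ x, realPotential A (f x)) < 0 := by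
  obtain ⟨b, hb⟩ := exists_bump_integral_realPotential_neg (d := d) hA
  set P := ∫ x, realPotential A (b x) with hP
  set G := ∫ x, ∑ j, partialDeriv j b x ^ 2 with hG
  have hG0 : 0 ≤ G := integral_nonneg fun x => by positivity
  -- Dilation by `R` gives `R^d (R⁻² G + P)`, negative as soon as `G < R²(-P)`. This `R` is at least
  -- `1` and satisfies `R(-P) = G - P > G`.
  set R := 1 + G / (-P) with hR
  have hGP : 0 ≤ G / (-P) := div_nonneg hG0 (by linarith)
  have hR1 : 1 ≤ R := by linarith
  have hR0 : 0 < R := by linarith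
  have hbd : ContDiff ℝ ∞ b := b.contDiff
  refine ⟨fun x => b (R⁻¹ • x), hbd.comp (contDiff_const_smul R⁻¹),
    b.hasCompactSupport.comp_smul (inv_ne_zero hR0.ne'), fun x => ⟨b.nonneg, b.le_one⟩, ?_⟩
  have hpd : ∀ x, ∀ j, partialDeriv j (fun x => b (R⁻¹ • x)) x =
      R⁻¹ * partialDeriv j b (R⁻¹ • x) := by
    intro x j
    simp only [partialDeriv]
    rw [fderiv_comp_smul]
    simp
  have h1 : ∫ x, ∑ j, partialDeriv j (fun x => b (R⁻¹ • x)) x ^ 2 = R ^ d * ((R⁻¹) ^ 2 * G) := by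
    simp only [hpd, mul_pow, ← Finset.mul_sum]
    rw [integral_const_mul, Measure.integral_comp_inv_smul_of_nonneg volume
      (fun x => ∑ j, partialDeriv j b x ^ 2) hR0.le, finrank_euclideanSpace_fin, smul_eq_mul]
    ring
  have h2 : ∫ x, realPotential A (b (R⁻¹ • x)) = R ^ d * P := by
    rw [Measure.integral_comp_inv_smul_of_nonneg volume
      (fun x => realPotential A (b x)) hR0.le, finrank_euclideanSpace_fin, smul_eq_mul]
  rw [h1, h2]
  have h3 : (R⁻¹) ^ 2 * G < -P := by
    have : G < R * (-P) := by
      rw [hR, add_mul, div_mul_cancel₀ _ (by linarith)]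
      linarith
    have h4 : R * (-P) ≤ R ^ 2 * (-P) :=
      mul_le_mul_of_nonneg_right (by nlinarith) (by linarith)
    rw [inv_pow, inv_mul_lt_iff₀ (by positivity)]
    linarith
  have h5 : R ^ d * ((R⁻¹) ^ 2 * G + P) < 0 := mul_neg_of_pos_of_neg (by positivity) (by linarith)
  linarith

theorem exists_tsupport_subset_slab [NeZero d] {f : EuclideanSpace ℝ (Fin d) → ℝ}
    (hc : HasCompactSupport f) : ∃ N : ℕ, 0 < N ∧ tsupport f ⊆ slab d N := by
  obtain ⟨r, hr⟩ := hc.isCompact.isBounded.subset_closedBall 0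
  obtain ⟨N, hN⟩ := exists_nat_gt (max r 0)
  refine ⟨N, by exact_mod_cast (le_max_right r 0).trans_lt hN, fun x hx => ?_⟩
  have h1 : ‖x‖ ≤ r := by simpa using hr hx
  have h2 : |x 0| ≤ ‖x‖ := PiLp.norm_apply_le x 0
  exact abs_lt.1 (h2.trans_lt (h1.trans_lt ((le_max_left r 0).trans_lt hN)))

theorem slab_mono [NeZero d] {M N : ℕ} (h : M ≤ N) : slab d M ⊆ slab d N := by
  have h' : (M : ℝ) ≤ N := by exact_mod_cast h
  exact fun x hx => ⟨by linarith [hx.1], by linarith [hx.2]⟩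

theorem ofTest_mem_H10 {Ω : Set (EuclideanSpace ℝ (Fin d))} {u : EuclideanSpace ℝ (Fin d) → ℂ}
    (hu : ContDiff ℝ ∞ u) (hc : HasCompactSupport u) (hs : tsupport u ⊆ Ω) :
    ofTest u hu hc ∈ H10 Ω :=
  Submodule.le_topologicalClosure _ ⟨u, hu, hc, hs, toFun_ofTest hu hc⟩

end CubicQuintic
end

/-! ### Conclusion -/

theorem mainTheorem2 (d : ℕ) [NeZero d] (hd : 2 ≤ d) (A : ℝ) (hA : A ∈ Set.Ioo (0 : ℝ) 1)
    (c₀ : ℝ) (hc₀ : c₀ ∈ Set.Ioo 0 (2 * Real.sqrt (1 - A))) :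
    ∃ (N₀ : ℕ) (φ₀ : CubicQuintic.H1 d) (χ : ℝ),
      0 < N₀ ∧ φ₀ ∈ CubicQuintic.H10 (CubicQuintic.slab d N₀) ∧ 0 < χ ∧
      ∀ N : ℕ, N₀ ≤ N → ∀ c ∈ Set.Ico c₀ (2 * Real.sqrt (1 - A)),
        CubicQuintic.action A c N φ₀ < 0 ∧
        0 < CubicQuintic.mountainPassLevel A c N φ₀ ∧
        CubicQuintic.mountainPassLevel A c N φ₀ ≤ (χ : EReal) := by
  open CubicQuintic in
  -- The profile is chosen from `d` and `A` alone, so one endpoint serves all admissible `c` and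
  -- `N`.
  obtain ⟨f, hf, hfc, hf01, hneg⟩ := exists_profile_energy_neg (d := d) hA.1
  obtain ⟨N₀, hN₀, hs⟩ := exists_tsupport_subset_slab hfc
  have hu := contDiff_neg_ofReal hf
  have huc := hasCompactSupport_neg_ofReal hfc
  have hus : tsupport (fun x => -(f x : ℂ)) ⊆ tsupport f :=
    closure_mono fun x hx h => hx (by simp [h])
  have hmem : ∀ N, N₀ ≤ N → ofTest _ hu huc ∈ H10 (slab d N) := fun N hN =>
    ofTest_mem_H10 hu huc (hus.trans (hs.trans (slab_mono hN)))
  have hχ : 0 ≤ 1 / 2 * (∫ x, ∑ j, partialDeriv j f x ^ 2) + 1 / 2 * volume.real (tsupport f) := by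
    have : 0 ≤ ∫ x, ∑ j, partialDeriv j f x ^ 2 := integral_nonneg fun x => by positivity
    positivity
  -- The added `1` makes `χ` strictly positive, the rest being only known to be nonnegative.
  refine ⟨N₀, ofTest _ hu huc, 1 / 2 * (∫ x, ∑ j, partialDeriv j f x ^ 2)
    + 1 / 2 * volume.real (tsupport f) + 1, hN₀, hmem N₀ le_rfl, by linarith,
    fun N hN c hc => ?_⟩
  have hsN := hs.trans (slab_mono hN)
  have hact : action A c N (ofTest _ hu huc) < 0 := by
    rw [action_eq_of_real c hf hfc hsN (toFun_ofTest hu huc)]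
    exact_mod_cast hneg
  have hc2 : c ^ 2 < 4 * (1 - A) := by
    have h0 : 0 ≤ c := hc₀.1.le.trans hc.1
    calc c ^ 2 < (2 * √(1 - A)) ^ 2 := pow_lt_pow_left₀ hc.2 h0 two_ne_zero
      _ = 4 * (1 - A) := by
        rw [mul_pow, Real.sq_sqrt (by linarith [hA.2])]
        norm_num
  refine ⟨hact, mountainPassLevel_pos hd hA.1.le hA.2 hc2 (hmem N hN) hact, ?_⟩
  refine (mountainPassLevel_le_of_real hA.1.le c hf hfc hsN hf01 (hmem N hN)
    (toFun_ofTest hu huc)).trans ?_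
  rw [EReal.coe_le_coe_iff]
  linarith
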